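/- Fix $\alpha>0$ and positive integers $M=M_N$ with $M_N/N^{1+\alpha}\to1$ as $N\to\infty$ (for instance $M_N=\lfloor N^{1+\alpha}\rfloor$). For each $N\ge 1$ let $(\eta(x,t),\,1\le x\le N;\ n_-(t),\,n_+(t))_{t\ge0}$ be the continuous-time Markov process on $\{0,1\}^{\{1,\dots,N\}}\times\{0,\dots,M\}\times\{0,\dots,M\}$ in which - for each $1\le x\le N-1$, the values $\eta(x)$ and $\eta(x+1)$ are exchanged at rate $\tfrac12$; - at rate $\tfrac12\big(1-\tfrac{n_-}{M}\big)\eta(1)+\tfrac12\,\tfrac{n_-}{M}(1-\eta(1))$ a particle moves between site $1$ and the left reservoir: $(\eta(1),n_-)$ goes from $(1,n_-)$ to $(0,n_-+1)$, or from $(0,n_-)$ to $(1,n_--1)$; - the same happens, with $N$ and $n_+$ in place of $1$ and $n_-$, at the right reservoir. Let $\mathbf P^N,\mathbf E^N$ be its law and expectation. Put $\eta(0,t)=n_-(t)/M$, $\eta(N+1,t)=n_+(t)/M$, $\rho^N(x,t)=\mathbf E^N[\eta(x,t)]$ for $0\le x\le N+1$, $\rho^N_-(t)=\rho^N(0,t)$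 and $\rho^N_+(t)=\rho^N(N+1,t)$. **Theorem (Adiabatic limit).** Let $u_0:(0,1]\to[0,1]$ be continuous on $(0,1)$ and let $v_{0,\pm}\in[0,1]$. Assume that the initial distributions satisfy $n_\pm(0)/M\to v_{0,\pm}$ in probability as $N\to\infty$, and $\rho^N(x,0)=u_0(x/N)$ for all $N\ge1$ and $1\le x\le N$. Then for all $r\in[0,1]$ and $t>0$, as $N\to\infty$, $$\rho^N_\pm(N^{2+\alpha}t)\to v_\pm(t),\qquad \rho^N(\lfloor Nr\rfloor,N^{2+\alpha}t)\to u(r,t):=\big(v_+(t)-v_-(t)\big)r+v_-(t),$$ where $v_\pm:[0,\infty)\to\mathbb R$ are continuous at $0$ with $v_\pm(0)=v_{0,\pm}$ and satisfy, for $t>0$, $$v_-'(t)=\tfrac12\big(v_+(t)-v_-(t)\big),\qquad v_+'(t)=-\tfrac12\big(v_+(t)-v_-(t)\big).$$ Explicitly, $v_\mp(t)=\dfrac{v_{0,-}+v_{0,+}}2\pm\dfrac{v_{0,-}-v_{0,+}}2\,e^{-t}$ for $t\ge0$. -/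

import Mathlib

open Filter Topology MeasureTheory

/-! ## Continuous-time Markov processes on a finite state space -/

section Markov

variable {S : Type*} [Fintype S] [DecidableEq S]

/-- The transition probability `p_t(a, b) = (e^{tL} 1_b)(a)` of the Markov semigroup generated by
an operator `L` acting on the functions on a finite set `S`. -/
noncomputable def transitionProb (L : (S → ℝ) →ₗ[ℝ] (S → ℝ)) (t : ℝ) (a b : S) : ℝ :=
  NormedSpace.exp (t • LinearMap.toContinuousLinearMap L) (Pi.single b 1) a

/-- `X` (only the times `t ≥ 0` matter) is a Markov process with generator `L` and arbitrary
initial distribution: its finite-dimensional distributions are given by the semigroup `e^{tL}`. -/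
structure IsMarkovProcess {Ω : Type*} [MeasurableSpace Ω] [MeasurableSpace S]
    (P : Measure Ω) (L : (S → ℝ) →ₗ[ℝ] (S → ℝ)) (X : ℝ → Ω → S) : Prop where
  measurable : ∀ t : ℝ, 0 ≤ t → Measurable (X t)
  finDimDist : ∀ (n : ℕ) (t : Fin (n + 1) → ℝ), 0 ≤ t 0 → Monotone t → ∀ a : Fin (n + 1) → S,
    P.real {w | ∀ i, X (t i) w = a i} =
      P.real {w | X (t 0) w = a 0} *
        ∏ i : Fin n, transitionProb L (t i.succ - t i.castSucc) (a i.castSucc) (a i.succ)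

end Markov

/-! ## The exclusion process in a channel with two particle reservoirs -/

namespace SSEP

/-- Configurations `(η, n₋, n₊)` in `{0,1}^{Λ_N} × {0,…,M} × {0,…,M}`; the site `x ∈ {1,…,N}` of
the channel is represented by `x - 1 : Fin N`, and `true` means that the site is occupied. -/
abbrev State (N M : ℕ) : Type := (Fin N → Bool) × Fin (M + 1) × Fin (M + 1)

variable {N M : ℕ}

/-- The channel occupation `η`. -/
def State.eta (ω : State N M) (x : Fin N) : Bool := ω.1 x

/-- The number of particles in the left reservoir. -/
def State.nLeft (ω : State N M) : Fin (M + 1) := ω.2.1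

/-- The number of particles in the right reservoir. -/
def State.nRight (ω : State N M) : Fin (M + 1) := ω.2.2

/-- `ω^{x,y}`: exchange the occupation numbers of the channel sites `x` and `y`. -/
def State.swap (ω : State N M) (x y : Fin N) : State N M :=
  (fun z => ω.eta (Equiv.swap x y z), ω.nLeft, ω.nRight)

/-- One more particle in a reservoir. (The truncation at `M` is never seen by the dynamics:
for `M ≥ 1` this move has rate zero when the reservoir is full.) -/
def incr (n : Fin (M + 1)) : Fin (M + 1) := ⟨min (n.val + 1) M, by omega⟩

/-- One particle fewer in a reservoir. (This move has rate zero when the reservoir is empty.) -/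
def decr (n : Fin (M + 1)) : Fin (M + 1) := ⟨n.val - 1, by omega⟩

/-- Change of a reservoir's content when it exchanges with a site whose occupation is `b`. -/
def exchange (b : Bool) (n : Fin (M + 1)) : Fin (M + 1) := if b then incr n else decr n

/-- `½ (1 - n/M) b + ½ (n/M) (1 - b)`: the rate of exchange between a boundary site with
occupation `b` and its reservoir containing `n` particles. -/
noncomputable def exchangeRate (b : Bool) (n : Fin (M + 1)) : ℝ :=
  if b then (1 / 2) * (1 - (n.val : ℝ) / M) else (1 / 2) * ((n.val : ℝ) / M)

/-- Move a particle between the channel site `x` and the left reservoir. -/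
def State.moveLeft (ω : State N M) (x : Fin N) : State N M :=
  (Function.update ω.eta x (!ω.eta x), exchange (ω.eta x) ω.nLeft, ω.nRight)

/-- Move a particle between the channel site `x` and the right reservoir. -/
def State.moveRight (ω : State N M) (x : Fin N) : State N M :=
  (Function.update ω.eta x (!ω.eta x), ω.nLeft, exchange (ω.eta x) ω.nRight)

/-- The generator of the process: stirring at rate `1/2` on the nearest neighbour bonds of the
channel, and exchange of the first (last) site with the left (right) reservoir. -/
noncomputable def generator (N M : ℕ) : (State N M → ℝ) →ₗ[ℝ] (State N M → ℝ) where
  toFun f ω :=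
    (1 / 2) * (∑ x : Fin N, ∑ y : Fin N,
      if x.val + 1 = y.val then f (ω.swap x y) - f ω else 0)
    + (∑ x : Fin N, if x.val + 1 = N then
        exchangeRate (ω.eta x) ω.nRight * (f (ω.moveRight x) - f ω) else 0)
    + ∑ x : Fin N, if x.val = 0 then
        exchangeRate (ω.eta x) ω.nLeft * (f (ω.moveLeft x) - f ω) else 0
  map_add' f g := by
    funext ω
    have h (p : Prop) [Decidable p] (c a b a' b' : ℝ) :
        (if p then c * (a + b - (a' + b')) else 0)
          = (if p then c * (a - a') else 0) + (if p then c * (b - b') else 0) := by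
      split_ifs <;> ring
    have h1 (p : Prop) [Decidable p] (a b a' b' : ℝ) :
        (if p then (a + b - (a' + b')) else 0)
          = (if p then (a - a') else 0) + (if p then (b - b') else 0) := by
      split_ifs <;> ring
    simp only [Pi.add_apply, h, h1, Finset.sum_add_distrib]
    ring
  map_smul' r f := by
    funext ω
    have h (p : Prop) [Decidable p] (c a a' : ℝ) :
        (if p then c * (r * a - r * a') else 0) = r * (if p then c * (a - a') else 0) := by
      split_ifs <;> ring
    have h1 (p : Prop) [Decidable p] (a a' : ℝ) :
        (if p then (r * a - r * a') else 0) = r * (if p then (a - a') else 0) := by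
      split_ifs <;> ring
    simp only [Pi.smul_apply, smul_eq_mul, RingHom.id_apply, h, h1, ← Finset.mul_sum]
    ring

/-- `η(x)` for `x ∈ {0,…,N+1}`: the occupation number of the channel site `x` if `1 ≤ x ≤ N`,
and the reservoir densities `η(0) = n₋/M`, `η(N+1) = n₊/M`. -/
noncomputable def State.occ (ω : State N M) (x : ℕ) : ℝ :=
  if x = 0 then (ω.nLeft.val : ℝ) / M
  else if h : x - 1 < N then (if ω.eta ⟨x - 1, h⟩ then 1 else 0)
  else (ω.nRight.val : ℝ) / M

/-- `ρ(x, t) = E[η(x, t)]`. -/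
noncomputable def density {Ω : Type*} [MeasurableSpace Ω] (P : Measure Ω)
    (X : ℝ → Ω → State N M) (x : ℕ) (t : ℝ) : ℝ :=
  ∫ w, (X t w).occ x ∂P

end SSEP

/-!
The mean occupation numbers solve a closed linear system: the discrete heat equation on
`1, …, N`, coupled at both ends to reservoirs that relax `M` times more slowly. It is reversible
for the weights `(M, 1, …, 1, M)`, so pairing it with the affine functions, which are harmonic in
the channel, leaves only boundary terms. Up to `O(N / M)`, the contribution of the channel, this
shows that the sum of the two reservoir densities is conserved and that their difference decays
at rate `1 / (M (N + 1))`. With these values at the boundary, the profile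
`u(x / (N + 1), t / (M (N + 1)))` is harmonic in space and slow in time, hence almost a solution
of the heat equation. The maximum principle bounds its distance to the density by
`3 (N + 1) / M + 2 exp (-t / (2 (N + 1) ^ 2))`: whatever the initial density in the channel, it is
forgotten after times of order `N ^ 2`, much shorter than the time scale `M N` of the reservoirs.
-/

/-! ## Expectations under a finite Markov process -/

section Markov

theorem hasDerivAt_exp_smul_apply {E : Type*} [NormedAddCommGroup E] [NormedSpace ℝ E]
    [CompleteSpace E] (A : E →L[ℝ] E) (v : E) (t : ℝ) :
    HasDerivAt (fun s : ℝ => NormedSpace.exp (s • A) v) (NormedSpace.exp (t • A) (A v)) t := by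
  simpa using (hasDerivAt_exp_smul_const (𝕂 := ℝ) A t).clm_apply (hasDerivAt_const t v)

variable {S Ω : Type*} [Fintype S] [MeasurableSpace Ω] {P : Measure Ω}

theorem sum_transitionProb_mul [DecidableEq S] (L : (S → ℝ) →ₗ[ℝ] (S → ℝ)) (t : ℝ) (a : S)
    (f : S → ℝ) :
    ∑ b, transitionProb L t a b * f b
      = NormedSpace.exp (t • LinearMap.toContinuousLinearMap L) f a := by
  conv_rhs => rw [pi_eq_sum_univ' f]
  simp [transitionProb, mul_comm]

variable [MeasurableSpace S]

theorem integral_comp_eq_sum_measureReal_mul [MeasurableSingletonClass S] [IsFiniteMeasure P]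
    {Y : Ω → S} (hY : Measurable Y) (f : S → ℝ) :
    ∫ w, f (Y w) ∂P = ∑ a, P.real {w | Y w = a} * f a := by
  rw [← integral_map (f := f) hY.aemeasurable (measurable_of_finite f).aestronglyMeasurable,
    integral_fintype Integrable.of_finite]
  refine Finset.sum_congr rfl fun a _ => ?_
  rw [map_measureReal_apply hY (measurableSet_singleton a), smul_eq_mul]
  rfl

namespace IsMarkovProcess

variable [DecidableEq S] {L : (S → ℝ) →ₗ[ℝ] (S → ℝ)} {X : ℝ → Ω → S} {t : ℝ}

theorem measureReal_and_eq (hX : IsMarkovProcess P L X) (ht : 0 ≤ t) (a b : S) :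
    P.real {w | X 0 w = a ∧ X t w = b} = P.real {w | X 0 w = a} * transitionProb L t a b := by
  have hmono : Monotone ![0, t] := by
    intro i j hij
    fin_cases i <;> fin_cases j <;> simp_all
  simpa [Fin.forall_fin_two] using hX.finDimDist 1 ![0, t] (by simp) hmono ![a, b]

variable [MeasurableSingletonClass S] [IsFiniteMeasure P]

theorem measureReal_eq_sum (hX : IsMarkovProcess P L X) (ht : 0 ≤ t) (b : S) :
    P.real {w | X t w = b} = ∑ a, P.real {w | X 0 w = a} * transitionProb L t a b := by
  have hmeas {s : ℝ} (hs : 0 ≤ s) (c : S) : MeasurableSet {w | X s w = c} :=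
    hX.measurable s hs (measurableSet_singleton c)
  simp_rw [← hX.measureReal_and_eq ht]
  rw [← measureReal_biUnion_finset]
  · congr 1
    ext w
    simp
  · exact fun a _ a' _ haa' => Set.disjoint_left.mpr fun w h h' => haa' (h.1.symm.trans h'.1)
  · exact fun a _ => (hmeas le_rfl a).inter (hmeas ht b)

theorem integral_comp_eq_sum_exp (hX : IsMarkovProcess P L X) (f : S → ℝ) (ht : 0 ≤ t) :
    ∫ w, f (X t w) ∂P = ∑ a, P.real {w | X 0 w = a} *
      NormedSpace.exp (t • LinearMap.toContinuousLinearMap L) f a := by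
  rw [integral_comp_eq_sum_measureReal_mul (hX.measurable t ht)]
  simp_rw [hX.measureReal_eq_sum ht, ← sum_transitionProb_mul, Finset.sum_mul, Finset.mul_sum]
  rw [Finset.sum_comm]
  simp only [mul_assoc]

theorem hasDerivWithinAt_integral_comp (hX : IsMarkovProcess P L X) (f : S → ℝ) (ht : 0 ≤ t) :
    HasDerivWithinAt (fun s => ∫ w, f (X s w) ∂P) (∫ w, L f (X t w) ∂P) (Set.Ici 0) t := by
  have hsum : HasDerivAt (fun s => ∑ a, P.real {w | X 0 w = a} *
      NormedSpace.exp (s • LinearMap.toContinuousLinearMap L) f a) (∫ w, L f (X t w) ∂P) t := by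
    rw [hX.integral_comp_eq_sum_exp (L f) ht]
    exact HasDerivAt.fun_sum fun a _ =>
      (hasDerivAt_pi.mp (hasDerivAt_exp_smul_apply _ f t) a).const_mul _
  exact hsum.hasDerivWithinAt.congr (fun s hs => hX.integral_comp_eq_sum_exp f hs)
    (hX.integral_comp_eq_sum_exp f ht)

end IsMarkovProcess

end Markov

namespace SSEP

variable {N M : ℕ}

namespace State

theorem occ_zero (ω : State N M) : ω.occ 0 = (ω.nLeft.val : ℝ) / M := by
  simp [occ]

theorem occ_succ (ω : State N M) (i : Fin N) : ω.occ (i + 1) = if ω.eta i then 1 else 0 := by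
  simp [occ]

theorem occ_last (ω : State N M) : ω.occ (N + 1) = (ω.nRight.val : ℝ) / M := by
  simp [occ]

theorem occ_mem_Icc (ω : State N M) (x : ℕ) : ω.occ x ∈ Set.Icc (0 : ℝ) 1 := by
  have hdiv (n : Fin (M + 1)) : (n.val : ℝ) / M ∈ Set.Icc (0 : ℝ) 1 :=
    ⟨by positivity, div_le_one_of_le₀ (by exact_mod_cast n.is_le) (by positivity)⟩
  unfold occ
  split_ifs
  exacts [hdiv _, ⟨zero_le_one, le_rfl⟩, ⟨le_rfl, zero_le_one⟩, hdiv _]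

end State

theorem exchangeRate_mul_exchange_sub (b : Bool) (n : Fin (M + 1)) :
    exchangeRate b n * (((exchange b n).val : ℝ) / M - (n.val : ℝ) / M)
      = ((if b then 1 else 0) - (n.val : ℝ) / M) / (2 * M) := by
  rcases M.eq_zero_or_pos with rfl | hM
  · simp
  have hM' : (M : ℝ) ≠ 0 := by positivity
  cases b
  · rcases n.val.eq_zero_or_pos with hn | hn
    · simp [exchangeRate, hn]
    · simp only [exchangeRate, exchange, decr, Bool.false_eq_true, if_false, Nat.cast_pred hn]
      field_simp
      ring
  · rcases n.is_le.eq_or_lt with hn | hn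
    · simp [exchangeRate, hn, hM']
    · simp only [exchangeRate, exchange, incr, if_true, min_eq_left (Nat.succ_le_of_lt hn)]
      push_cast
      field_simp
      ring

theorem exchangeRate_mul_not_sub (b : Bool) (n : Fin (M + 1)) :
    exchangeRate b n * ((if !b then 1 else 0) - if b then 1 else 0)
      = ((n.val : ℝ) / M - if b then 1 else 0) / 2 := by
  cases b <;> simp [exchangeRate] <;> ring

theorem exchangeRate_mul_moveLeft_occ_sub (ω : State N M) (x i : Fin N) :
    exchangeRate (ω.eta x) ω.nLeft * ((ω.moveLeft x).occ (i + 1) - ω.occ (i + 1))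
      = if x = i then (ω.occ 0 - ω.occ (i + 1)) / 2 else 0 := by
  have heta : (ω.moveLeft x).eta = Function.update ω.eta x (!ω.eta x) := rfl
  rw [State.occ_succ, State.occ_succ, State.occ_zero, heta]
  rcases eq_or_ne x i with rfl | hne
  · rw [Function.update_self, exchangeRate_mul_not_sub, if_pos rfl]
  · rw [Function.update_of_ne hne.symm, sub_self, mul_zero, if_neg hne]

theorem exchangeRate_mul_moveRight_occ_sub (ω : State N M) (x i : Fin N) :
    exchangeRate (ω.eta x) ω.nRight * ((ω.moveRight x).occ (i + 1) - ω.occ (i + 1))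
      = if x = i then (ω.occ (N + 1) - ω.occ (i + 1)) / 2 else 0 := by
  have heta : (ω.moveRight x).eta = Function.update ω.eta x (!ω.eta x) := rfl
  rw [State.occ_succ, State.occ_succ, State.occ_last, heta]
  rcases eq_or_ne x i with rfl | hne
  · rw [Function.update_self, exchangeRate_mul_not_sub, if_pos rfl]
  · rw [Function.update_of_ne hne.symm, sub_self, mul_zero, if_neg hne]

theorem sum_ite_val_eq (k : ℕ) (g : ℕ → ℝ) :
    ∑ x : Fin N, (if x.val = k then g x else 0) = if k < N then g k else 0 := by
  rw [Fin.sum_univ_eq_sum_range fun x => if x = k then g x else 0]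
  simp

theorem sum_adjacent_swap_sub (e : ℕ → ℝ) (i : Fin N) :
    (∑ x : Fin N, ∑ y : Fin N, if x.val + 1 = y.val then e (Equiv.swap x y i) - e i else 0)
      = (if i + 1 < N then e (i + 1) - e i else 0)
        + (if 0 < i.val then e (i - 1) - e i else 0) := by
  have hbond (x y : Fin N) : (if x.val + 1 = y.val then e (Equiv.swap x y i) - e i else 0)
      = (if x = i then if y.val = i + 1 then e y - e i else 0 else 0)
        + (if y = i then if 0 < i.val then if x.val = i - 1 then e x - e i else 0 else 0
          else 0) := by
    rcases eq_or_ne x i with rfl | hx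
    · rcases eq_or_ne y x with rfl | hy
      · grind
      · simp [hy, eq_comm]
    · rcases eq_or_ne y i with rfl | hy
      · simp only [Equiv.swap_apply_right]
        grind
      · simp [hx, hy, Equiv.swap_apply_of_ne_of_ne hx.symm hy.symm]
  simp only [hbond, Finset.sum_add_distrib]
  congr 1
  · rw [Finset.sum_comm]
    simp only [Finset.sum_ite_eq', Finset.mem_univ, if_true,
      sum_ite_val_eq (i + 1) fun y => e y - e i]
  · simp only [Finset.sum_ite_eq', Finset.mem_univ, if_true]
    split_ifs with hi
    · rw [sum_ite_val_eq (i - 1) fun x => e x - e i, if_pos (by omega)]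
    · exact Finset.sum_const_zero

theorem generator_occ_zero (hN : 0 < N) (ω : State N M) :
    generator N M (fun ω => ω.occ 0) ω = (ω.occ 1 - ω.occ 0) / (2 * M) := by
  have hswap (x y : Fin N) : (ω.swap x y).occ 0 = ω.occ 0 := by simp only [State.occ_zero]; rfl
  have hright (x : Fin N) : (ω.moveRight x).occ 0 = ω.occ 0 := by simp only [State.occ_zero]; rfl
  have hleft (x : Fin N) : exchangeRate (ω.eta x) ω.nLeft * ((ω.moveLeft x).occ 0 - ω.occ 0)
      = (ω.occ (x + 1) - ω.occ 0) / (2 * M) := by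
    rw [State.occ_succ, State.occ_zero, State.occ_zero, ← exchangeRate_mul_exchange_sub]
    rfl
  have hsum := sum_ite_val_eq (N := N) 0 fun x => (ω.occ (x + 1) - ω.occ 0) / (2 * M)
  simp [generator, hswap, hright, hleft, hsum, hN]

theorem generator_occ_last (hN : 0 < N) (ω : State N M) :
    generator N M (fun ω => ω.occ (N + 1)) ω = (ω.occ N - ω.occ (N + 1)) / (2 * M) := by
  have hswap (x y : Fin N) : (ω.swap x y).occ (N + 1) = ω.occ (N + 1) := by
    simp only [State.occ_last]; rfl
  have hleft (x : Fin N) : (ω.moveLeft x).occ (N + 1) = ω.occ (N + 1) := by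
    simp only [State.occ_last]; rfl
  have hright (x : Fin N) :
      exchangeRate (ω.eta x) ω.nRight * ((ω.moveRight x).occ (N + 1) - ω.occ (N + 1))
        = (ω.occ (x + 1) - ω.occ (N + 1)) / (2 * M) := by
    rw [State.occ_succ, State.occ_last, State.occ_last, ← exchangeRate_mul_exchange_sub]
    rfl
  have hsum := sum_ite_val_eq (N := N) (N - 1)
    fun x => (ω.occ (x + 1) - ω.occ (N + 1)) / (2 * M)
  have hiff (x : Fin N) : x.val + 1 = N ↔ x.val = N - 1 := by omega
  simp [generator, hswap, hright, hleft, hiff, hsum, hN, Nat.sub_add_cancel hN]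

theorem generator_occ_succ (i : Fin N) (ω : State N M) :
    generator N M (fun ω => ω.occ (i + 1)) ω
      = (ω.occ i + ω.occ (i + 2) - 2 * ω.occ (i + 1)) / 2 := by
  have hswap (x y : Fin N) : (ω.swap x y).occ (i + 1) = ω.occ (Equiv.swap x y i + 1) := by
    rw [State.occ_succ, State.occ_succ]
    rfl
  have hbulk := sum_adjacent_swap_sub (fun x => ω.occ (x + 1)) i
  have hright : ∑ x : Fin N, (if x.val + 1 = N then
      if x = i then (ω.occ (N + 1) - ω.occ (i + 1)) / 2 else 0 else 0)
      = if i.val + 1 = N then (ω.occ (N + 1) - ω.occ (i + 1)) / 2 else 0 := by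
    rw [Fintype.sum_eq_single i fun x hx => by simp [hx], if_pos rfl]
  have hleft : ∑ x : Fin N, (if x.val = 0 then
      if x = i then (ω.occ 0 - ω.occ (i + 1)) / 2 else 0 else 0)
      = if i.val = 0 then (ω.occ 0 - ω.occ (i + 1)) / 2 else 0 := by
    rw [Fintype.sum_eq_single i fun x hx => by simp [hx], if_pos rfl]
  simp only [generator, LinearMap.coe_mk, AddHom.coe_mk, exchangeRate_mul_moveLeft_occ_sub,
    exchangeRate_mul_moveRight_occ_sub, hswap, hbulk, hright, hleft]
  grind

end SSEP

/-! ## Maximum principle for the discrete heat equation -/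

section MaximumPrinciple

open Set

theorem nonpos_of_deriv_nonpos_at_max {ι : Type*} [Finite ι] {f f' : ι → ℝ → ℝ}
    (hf : ∀ i t, 0 ≤ t → HasDerivWithinAt (f i) (f' i t) (Ici 0) t) (h0 : ∀ i, f i 0 ≤ 0)
    (hmax : ∀ i t, 0 ≤ t → 0 < f i t → (∀ j, f j t ≤ f i t) → f' i t ≤ 0) {t : ℝ} (ht : 0 ≤ t)
    (i : ι) : f i t ≤ 0 := by
  by_contra! hpos
  obtain ⟨ε, hε, hεt⟩ : ∃ ε > 0, f i t = ε * (t + 1) :=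
    ⟨f i t / (t + 1), by positivity, by field_simp⟩
  -- Subtracting `ε * s` makes the derivative strictly negative at a positive maximum.
  have hderiv (j : ι) (s : ℝ) (hs : s ∈ Icc 0 t) :
      HasDerivWithinAt (fun s => f j s - ε * s) (f' j s - ε) (Icc 0 t) s := by
    simpa using ((hf j s hs.1).mono Icc_subset_Ici_self).fun_sub
      ((hasDerivWithinAt_id s _).const_mul ε)
  have hexists (j : ι) : ∃ s ∈ Icc 0 t, IsMaxOn (fun s => f j s - ε * s) (Icc 0 t) s :=
    isCompact_Icc.exists_isMaxOn (nonempty_Icc.mpr ht) fun s hs =>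
      (hderiv j s hs).continuousWithinAt
  choose s hs hsmax using hexists
  have : Nonempty ι := ⟨i⟩
  obtain ⟨m, hm⟩ := Finite.exists_max fun j => f j (s j) - ε * s j
  have hge (j : ι) (r : ℝ) (hr : r ∈ Icc 0 t) : f j r - ε * r ≤ f m (s m) - ε * s m :=
    (hsmax j hr).trans (hm j)
  have hvalue : ε ≤ f m (s m) - ε * s m := by linarith [hge i t ⟨ht, le_rfl⟩]
  have hs_pos : 0 < s m := by
    refine (hs m).1.lt_of_ne fun hzero => ?_
    rw [← hzero] at hvalue
    linarith [h0 m]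
  have hle : f' m (s m) ≤ 0 :=
    hmax m (s m) hs_pos.le (by nlinarith) fun j => by linarith [hge j (s m) (hs m)]
  have hseg : segment ℝ (s m) 0 ⊆ Icc 0 t :=
    (convex_Icc 0 t).segment_subset (hs m) ⟨le_rfl, ht⟩
  have hleft := (hsmax m).localize.hasFDerivWithinAt_nonpos
    (hderiv m (s m) (hs m)).hasFDerivWithinAt
    (sub_mem_posTangentConeAt_of_segment_subset hseg)
  simp only [ContinuousLinearMap.toSpanSingleton_apply, smul_eq_mul] at hleft
  nlinarith

variable {N : ℕ} {f f' : ℕ → ℝ → ℝ}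

theorem nonpos_of_heat_subsolution
    (hf : ∀ x < N, ∀ t, 0 ≤ t → HasDerivWithinAt (f (x + 1)) (f' x t) (Ici 0) t)
    (hf' : ∀ x < N, ∀ t, 0 ≤ t → f' x t ≤ (f x t + f (x + 2) t - 2 * f (x + 1) t) / 2)
    (h0 : ∀ x < N, f (x + 1) 0 ≤ 0) (hleft : ∀ t, 0 ≤ t → f 0 t ≤ 0)
    (hright : ∀ t, 0 ≤ t → f (N + 1) t ≤ 0) {x : ℕ} (hx : x ≤ N + 1) {t : ℝ} (ht : 0 ≤ t) :
    f x t ≤ 0 := by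
  have hbulk (i : Fin N) : f (i + 1) t ≤ 0 := by
    refine nonpos_of_deriv_nonpos_at_max (f := fun (i : Fin N) => f (i + 1)) (fun i => hf i i.2)
      (fun i => h0 i i.2) (fun i s hs hpos hmax => (hf' i i.2 s hs).trans ?_) ht i
    have hneighbour (y : ℕ) (hy : y ≤ N + 1) : f y s ≤ f (i + 1) s := by
      rcases Nat.eq_zero_or_eq_succ_pred y with rfl | hy'
      · exact (hleft s hs).trans hpos.le
      · rcases hy.eq_or_lt with rfl | hlt
        · exact (hright s hs).trans hpos.le
        · rw [hy']
          exact hmax ⟨y.pred, by grind⟩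
    linarith [hneighbour i (by omega), hneighbour (i + 2) (by omega)]
  rcases x.eq_zero_or_pos with rfl | hx0
  · exact hleft t ht
  · rcases hx.eq_or_lt with rfl | hlt
    · exact hright t ht
    · simpa only [Nat.sub_add_cancel hx0] using hbulk ⟨x - 1, by omega⟩

/-- A supersolution of the discrete heat equation with source `κ` on `{0, …, l}`. It dominates `A`
at time `0` and forgets `A` after times of order `l ^ 2`: the concave factor `2 - (x / l) ^ 2` lies
in `[1, 2]` and has discrete Laplacian `-2 / l ^ 2`. -/
noncomputable def heatBarrier (A κ l x t : ℝ) : ℝ :=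
  (κ * l ^ 2 + A * Real.exp (-t / (2 * l ^ 2))) * (2 - (x / l) ^ 2)

variable {A κ l x t : ℝ}

theorem le_heatBarrier_zero (hA : 0 ≤ A) (hκ : 0 ≤ κ) (hx : 0 ≤ x) (hxl : x ≤ l) :
    A ≤ heatBarrier A κ l x 0 := by
  have hratio : (x / l) ^ 2 ≤ 1 :=
    pow_le_one₀ (div_nonneg hx (hx.trans hxl)) (div_le_one_of_le₀ hxl (hx.trans hxl))
  have hsource : 0 ≤ κ * l ^ 2 := by positivity
  simp only [heatBarrier, neg_zero, zero_div, Real.exp_zero, mul_one]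
  nlinarith

theorem heatBarrier_nonneg (hA : 0 ≤ A) (hκ : 0 ≤ κ) (hx : 0 ≤ x) (hxl : x ≤ l) :
    0 ≤ heatBarrier A κ l x t := by
  have hratio : (x / l) ^ 2 ≤ 1 :=
    pow_le_one₀ (div_nonneg hx (hx.trans hxl)) (div_le_one_of_le₀ hxl (hx.trans hxl))
  exact mul_nonneg (by positivity) (by linarith)

theorem heatBarrier_le (hA : 0 ≤ A) (hκ : 0 ≤ κ) :
    heatBarrier A κ l x t ≤ 2 * (κ * l ^ 2 + A * Real.exp (-t / (2 * l ^ 2))) := by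
  rw [heatBarrier, mul_comm]
  exact mul_le_mul_of_nonneg_right (sub_le_self 2 (sq_nonneg _)) (by positivity)

theorem hasDerivAt_heatBarrier :
    HasDerivAt (heatBarrier A κ l x)
      (-(A * Real.exp (-t / (2 * l ^ 2))) / (2 * l ^ 2) * (2 - (x / l) ^ 2)) t := by
  have h := ((((hasDerivAt_id' t).fun_neg.div_const (2 * l ^ 2)).exp.const_mul A).const_add
    (κ * l ^ 2)).mul_const (2 - (x / l) ^ 2)
  exact h.congr_deriv (by ring)

theorem heatBarrier_supersolution (hA : 0 ≤ A) (hl : l ≠ 0) :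
    (heatBarrier A κ l x t + heatBarrier A κ l (x + 2) t - 2 * heatBarrier A κ l (x + 1) t) / 2 + κ
      ≤ -(A * Real.exp (-t / (2 * l ^ 2))) / (2 * l ^ 2) * (2 - ((x + 1) / l) ^ 2) := by
  have hlaplacian : (heatBarrier A κ l x t + heatBarrier A κ l (x + 2) t
      - 2 * heatBarrier A κ l (x + 1) t) / 2 + κ
      = -(A * Real.exp (-t / (2 * l ^ 2))) / (2 * l ^ 2) * 2 := by
    simp only [heatBarrier]
    field_simp
    ring
  rw [hlaplacian]
  refine mul_le_mul_of_nonpos_left (sub_le_self 2 (sq_nonneg _)) ?_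
  rw [neg_div]
  exact neg_nonpos.mpr (by positivity)

theorem le_of_heat_subsolution_with_source {N : ℕ} {A κ δ : ℝ} {f f' : ℕ → ℝ → ℝ} (hA : 0 ≤ A)
    (hκ : 0 ≤ κ) (hδ : 0 ≤ δ)
    (hf : ∀ x < N, ∀ t, 0 ≤ t → HasDerivWithinAt (f (x + 1)) (f' x t) (Ici 0) t)
    (hf' : ∀ x < N, ∀ t, 0 ≤ t → f' x t ≤ (f x t + f (x + 2) t - 2 * f (x + 1) t) / 2 + κ)
    (h0 : ∀ x < N, f (x + 1) 0 ≤ A) (hleft : ∀ t, 0 ≤ t → f 0 t ≤ δ)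
    (hright : ∀ t, 0 ≤ t → f (N + 1) t ≤ δ) {x : ℕ} (hx : x ≤ N + 1) {t : ℝ} (ht : 0 ≤ t) :
    f x t ≤ δ + 2 * (κ * (N + 1) ^ 2 + A * Real.exp (-t / (2 * (N + 1) ^ 2))) := by
  have hcast {y : ℕ} (hy : y ≤ N + 1) : (y : ℝ) ≤ N + 1 := by exact_mod_cast hy
  have hnonneg {y : ℕ} (hy : y ≤ N + 1) (s : ℝ) : 0 ≤ heatBarrier A κ (N + 1) y s :=
    heatBarrier_nonneg hA hκ y.cast_nonneg (hcast hy)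
  suffices h : f x t - δ - heatBarrier A κ (N + 1) x t ≤ 0 by
    linarith [heatBarrier_le (x := x) (l := N + 1) (t := t) hA hκ]
  refine nonpos_of_heat_subsolution
    (f := fun y s => f y s - δ - heatBarrier A κ (N + 1) y s)
    (fun y hy s hs => ((hf y hy s hs).sub_const δ).fun_sub hasDerivAt_heatBarrier.hasDerivWithinAt)
    (fun y hy s hs => ?_) (fun y hy => ?_) (fun s hs => ?_) (fun s hs => ?_) hx ht
  · have hbarrier := heatBarrier_supersolution (κ := κ) (l := N + 1) (x := y) (t := s) hA
      (by positivity)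
    push_cast
    linarith [hf' y hy s hs]
  · linarith [h0 y hy,
      le_heatBarrier_zero hA hκ (y + 1).cast_nonneg (hcast (Nat.succ_le_succ hy.le))]
  · linarith [hleft s hs, hnonneg (Nat.zero_le _) s]
  · linarith [hright s hs, hnonneg le_rfl s]

theorem abs_le_of_abs_deriv_sub_laplacian_le {N : ℕ} {A κ δ : ℝ} {f f' : ℕ → ℝ → ℝ} (hA : 0 ≤ A)
    (hκ : 0 ≤ κ) (hδ : 0 ≤ δ)
    (hf : ∀ x < N, ∀ t, 0 ≤ t → HasDerivWithinAt (f (x + 1)) (f' x t) (Ici 0) t)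
    (hf' : ∀ x < N, ∀ t, 0 ≤ t → |f' x t - (f x t + f (x + 2) t - 2 * f (x + 1) t) / 2| ≤ κ)
    (h0 : ∀ x < N, |f (x + 1) 0| ≤ A) (hleft : ∀ t, 0 ≤ t → |f 0 t| ≤ δ)
    (hright : ∀ t, 0 ≤ t → |f (N + 1) t| ≤ δ) {x : ℕ} (hx : x ≤ N + 1) {t : ℝ} (ht : 0 ≤ t) :
    |f x t| ≤ δ + 2 * (κ * (N + 1) ^ 2 + A * Real.exp (-t / (2 * (N + 1) ^ 2))) := by
  refine abs_le'.mpr ⟨?_, ?_⟩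
  · exact le_of_heat_subsolution_with_source hA hκ hδ hf
      (fun y hy s hs => by linarith [(abs_le.mp (hf' y hy s hs)).2])
      (fun y hy => (abs_le.mp (h0 y hy)).2) (fun s hs => (abs_le.mp (hleft s hs)).2)
      (fun s hs => (abs_le.mp (hright s hs)).2) hx ht
  · exact le_of_heat_subsolution_with_source (f := fun y s => -f y s) hA hκ hδ
      (fun y hy s hs => (hf y hy s hs).fun_neg)
      (fun y hy s hs => by linarith [(abs_le.mp (hf' y hy s hs)).1])
      (fun y hy => neg_le.mp (abs_le.mp (h0 y hy)).1)
      (fun s hs => neg_le.mp (abs_le.mp (hleft s hs)).1)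
      (fun s hs => neg_le.mp (abs_le.mp (hright s hs)).1) hx ht

end MaximumPrinciple

section PerturbedDecay

variable {z D : ℝ → ℝ} {lam δ t : ℝ}

theorem abs_exp_mul_sub_le_of_hasDerivWithinAt (hlam : 0 ≤ lam)
    (hz : ∀ t, 0 ≤ t → HasDerivWithinAt z (-lam * D t) (Set.Ici 0) t)
    (hδ : ∀ t, 0 ≤ t → |z t - D t| ≤ δ) (ht : 0 ≤ t) :
    |Real.exp (lam * t) * z t - z 0| ≤ δ * (Real.exp (lam * t) - 1) := by
  have hexp (s : ℝ) : HasDerivAt (fun s => Real.exp (lam * s)) (lam * Real.exp (lam * s)) s := by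
    simpa [mul_comm] using ((hasDerivAt_id s).const_mul lam).exp
  have hderiv (s : ℝ) (hs : 0 ≤ s) :
      HasDerivWithinAt (fun s => Real.exp (lam * s) * z s - z 0)
        (lam * Real.exp (lam * s) * (z s - D s)) (Set.Ici 0) s :=
    (((hexp s).hasDerivWithinAt.fun_mul (hz s hs)).sub_const (z 0)).congr_deriv (by ring)
  refine image_norm_le_of_norm_deriv_right_le_deriv_boundary (a := 0) (b := t)
    (B := fun s => δ * (Real.exp (lam * s) - 1))
    (fun s hs => (hderiv s hs.1).continuousWithinAt.mono Set.Icc_subset_Ici_self)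
    (fun s hs => (hderiv s hs.1).mono (Set.Ici_subset_Ici.mpr hs.1)) (by simp)
    (fun s => ((hexp s).sub_const 1).const_mul δ) (fun s hs => ?_) ⟨ht, le_rfl⟩
  rw [norm_mul, Real.norm_of_nonneg (by positivity), mul_comm δ]
  exact mul_le_mul_of_nonneg_left (hδ s hs.1) (by positivity)

theorem abs_sub_exp_mul_le_of_hasDerivWithinAt (hlam : 0 ≤ lam)
    (hz : ∀ t, 0 ≤ t → HasDerivWithinAt z (-lam * D t) (Set.Ici 0) t)
    (hδ : ∀ t, 0 ≤ t → |z t - D t| ≤ δ) (ht : 0 ≤ t) :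
    |D t - Real.exp (-(lam * t)) * D 0| ≤ 2 * δ := by
  let E := Real.exp (lam * t)
  have hE : 0 < E := Real.exp_pos _
  have hz_bound := abs_exp_mul_sub_le_of_hasDerivWithinAt hlam hz hδ ht
  have hscaled : |E * D t - D 0| ≤ 2 * δ * E :=
    calc |E * D t - D 0| = |(E * z t - z 0) + ((z 0 - D 0) - E * (z t - D t))| := by ring_nf
      _ ≤ |E * z t - z 0| + (|z 0 - D 0| + |E * (z t - D t)|) :=
          (abs_add_le _ _).trans (add_le_add_right (abs_sub _ _) _)
      _ ≤ δ * (E - 1) + (δ + E * δ) := by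
          rw [abs_mul, abs_of_pos hE]
          gcongr
          exacts [hδ 0 le_rfl, hδ t ht]
      _ = 2 * δ * E := by ring
  calc |D t - Real.exp (-(lam * t)) * D 0| = |E⁻¹ * (E * D t - D 0)| := by
        rw [Real.exp_neg, mul_sub, inv_mul_cancel_left₀ hE.ne']
    _ = |E * D t - D 0| / E := by rw [abs_mul, abs_of_pos (inv_pos.mpr hE), inv_mul_eq_div]
    _ ≤ 2 * δ := (div_le_iff₀ hE).mpr hscaled

end PerturbedDecay

/-! ## Density flow with slow reservoirs -/

namespace SSEP

/-- The limiting density profile `u(r, t)` for the initial reservoir densities `a` and `b`, in a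
form that is affine in `r`; `v_-` and `v_+` are its values at `r = 0` and `r = 1`. -/
noncomputable def adiabaticProfile (a b r t : ℝ) : ℝ :=
  (a + b) / 2 + (b - a) * (r - 1 / 2) * Real.exp (-t)

theorem natCast_div_add_one_mem_Icc {N x : ℕ} (hx : x ≤ N + 1) :
    (x : ℝ) / (N + 1) ∈ Set.Icc (0 : ℝ) 1 :=
  ⟨by positivity, div_le_one_of_le₀ (by exact_mod_cast hx) (by positivity)⟩

section AdiabaticProfile

variable (a b r t : ℝ)

theorem hasDerivAt_adiabaticProfile :
    HasDerivAt (adiabaticProfile a b r) (-((b - a) * (r - 1 / 2) * Real.exp (-t))) t := by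
  have h := ((hasDerivAt_neg t).exp.const_mul ((b - a) * (r - 1 / 2))).const_add ((a + b) / 2)
  exact h.congr_deriv (by ring)

theorem hasDerivAt_adiabaticProfile_left :
    HasDerivAt (adiabaticProfile a b 0)
      (1 / 2 * (adiabaticProfile a b 1 t - adiabaticProfile a b 0 t)) t :=
  (hasDerivAt_adiabaticProfile a b 0 t).congr_deriv (by simp only [adiabaticProfile]; ring)

theorem hasDerivAt_adiabaticProfile_right :
    HasDerivAt (adiabaticProfile a b 1)
      (-(1 / 2) * (adiabaticProfile a b 1 t - adiabaticProfile a b 0 t)) t :=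
  (hasDerivAt_adiabaticProfile a b 1 t).congr_deriv (by simp only [adiabaticProfile]; ring)

theorem hasDerivAt_adiabaticProfile_div (T : ℝ) :
    HasDerivAt (fun t => adiabaticProfile a b r (t / T))
      (-((b - a) * (r - 1 / 2) * Real.exp (-(t / T)) / T)) t := by
  have h := (hasDerivAt_adiabaticProfile a b r (t / T)).comp t ((hasDerivAt_id' t).div_const T)
  exact h.congr_deriv (by ring)

theorem adiabaticProfile_laplacian (x l : ℝ) :
    adiabaticProfile a b (x / l) t + adiabaticProfile a b ((x + 2) / l) t
      - 2 * adiabaticProfile a b ((x + 1) / l) t = 0 := by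
  simp only [adiabaticProfile]
  ring

theorem adiabaticProfile_eq_interpolation :
    adiabaticProfile a b r t
      = (adiabaticProfile a b 1 t - adiabaticProfile a b 0 t) * r + adiabaticProfile a b 0 t := by
  simp only [adiabaticProfile]
  ring

theorem adiabaticProfile_zero : adiabaticProfile a b r 0 = (1 - r) * a + r * b := by
  simp only [adiabaticProfile, neg_zero, Real.exp_zero]
  ring

theorem tendsto_adiabaticProfile_nhdsGT_zero :
    Tendsto (adiabaticProfile a b r) (𝓝[>] 0) (𝓝 ((1 - r) * a + r * b)) := by
  rw [← adiabaticProfile_zero]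
  exact (hasDerivAt_adiabaticProfile a b r 0).continuousAt.tendsto.mono_left nhdsWithin_le_nhds

variable {a b r}

theorem adiabaticProfile_zero_mem_Icc (ha : a ∈ Set.Icc (0 : ℝ) 1) (hb : b ∈ Set.Icc (0 : ℝ) 1)
    (hr : r ∈ Set.Icc (0 : ℝ) 1) : adiabaticProfile a b r 0 ∈ Set.Icc (0 : ℝ) 1 := by
  rw [adiabaticProfile_zero]
  exact convex_Icc 0 1 ha hb (sub_nonneg.mpr hr.2) hr.1 (sub_add_cancel 1 r)

variable {t}

theorem abs_deriv_adiabaticProfile_div_le (ha : a ∈ Set.Icc (0 : ℝ) 1)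
    (hb : b ∈ Set.Icc (0 : ℝ) 1) (hr : r ∈ Set.Icc (0 : ℝ) 1) (ht : 0 ≤ t) {T : ℝ} (hT : 0 ≤ T) :
    |(b - a) * (r - 1 / 2) * Real.exp (-(t / T)) / T| ≤ 1 / 2 / T := by
  have hdiff : |b - a| ≤ 1 := abs_le.mpr ⟨by linarith [ha.2, hb.1], by linarith [ha.1, hb.2]⟩
  have hcentre : |r - 1 / 2| ≤ 1 / 2 := abs_le.mpr ⟨by linarith [hr.1], by linarith [hr.2]⟩
  have hexp : Real.exp (-(t / T)) ≤ 1 :=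
    Real.exp_le_one_iff.mpr (neg_nonpos.mpr (div_nonneg ht hT))
  calc |(b - a) * (r - 1 / 2) * Real.exp (-(t / T)) / T|
      = |b - a| * |r - 1 / 2| * Real.exp (-(t / T)) / T := by
        rw [abs_div, abs_mul, abs_mul, Real.abs_exp, abs_of_nonneg hT]
    _ ≤ 1 * (1 / 2) * 1 / T := by gcongr
    _ = 1 / 2 / T := by norm_num

end AdiabaticProfile

/-- The equations satisfied by the mean occupation numbers of the exclusion process: the discrete
heat equation on the sites `1, …, N`, coupled to two reservoirs, the sites `0` and `N + 1`, that
relax `M` times more slowly. -/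
structure IsReservoirHeatFlow (N M : ℕ) (ρ : ℕ → ℝ → ℝ) : Prop where
  left : ∀ t, 0 ≤ t → HasDerivWithinAt (ρ 0) ((ρ 1 t - ρ 0 t) / (2 * M)) (Set.Ici 0) t
  right : ∀ t, 0 ≤ t →
    HasDerivWithinAt (ρ (N + 1)) ((ρ N t - ρ (N + 1) t) / (2 * M)) (Set.Ici 0) t
  channel : ∀ x < N, ∀ t, 0 ≤ t → HasDerivWithinAt (ρ (x + 1))
    ((ρ x t + ρ (x + 2) t - 2 * ρ (x + 1) t) / 2) (Set.Ici 0) t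
  mem_Icc : ∀ x ≤ N + 1, ∀ t, 0 ≤ t → ρ x t ∈ Set.Icc (0 : ℝ) 1

section Density

variable {N M : ℕ} {Ω : Type*} [MeasurableSpace Ω] {P : Measure Ω} {X : ℝ → Ω → State N M}

theorem integrable_occ_comp [IsFiniteMeasure P] {Y : Ω → State N M} (hY : Measurable Y) (x : ℕ) :
    Integrable (fun w => (Y w).occ x) P :=
  (Integrable.of_finite (f := fun ω : State N M => ω.occ x)).comp_measurable hY

theorem isReservoirHeatFlow_density [IsProbabilityMeasure P] (hN : 0 < N)
    (hX : IsMarkovProcess P (generator N M) X) : IsReservoirHeatFlow N M (density P X) := by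
  have hint {t : ℝ} (ht : 0 ≤ t) (x : ℕ) : Integrable (fun w => (X t w).occ x) P :=
    integrable_occ_comp (hX.measurable t ht) x
  refine ⟨fun t ht => ?_, fun t ht => ?_, fun x hx t ht => ?_, fun x _ t ht => ⟨?_, ?_⟩⟩
  · refine (hX.hasDerivWithinAt_integral_comp (fun ω => ω.occ 0) ht).congr_deriv ?_
    simp only [generator_occ_zero hN]
    rw [integral_div, integral_sub (hint ht 1) (hint ht 0)]
    rfl
  · refine (hX.hasDerivWithinAt_integral_comp (fun ω => ω.occ (N + 1)) ht).congr_deriv ?_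
    simp only [generator_occ_last hN]
    rw [integral_div, integral_sub (hint ht N) (hint ht (N + 1))]
    rfl
  · refine (hX.hasDerivWithinAt_integral_comp (fun ω => ω.occ (x + 1)) ht).congr_deriv ?_
    simp only [generator_occ_succ ⟨x, hx⟩]
    rw [integral_div,
      integral_sub ((hint ht x).fun_add (hint ht (x + 2))) ((hint ht _).const_mul 2),
      integral_add (hint ht x) (hint ht (x + 2)), integral_const_mul]
    rfl
  · exact integral_nonneg fun w => ((X t w).occ_mem_Icc x).1
  · simpa [density] using
      integral_mono (hint ht x) (integrable_const 1) fun w => ((X t w).occ_mem_Icc x).2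

end Density

/-- The pairing of `ρ` with the affine function `x ↦ c + s * x` in the reversible measure
`(M, 1, …, 1, M)` of the flow, divided by `M`. Affine functions are harmonic in the channel, so that
it changes only through the boundary. -/
noncomputable def affineMoment (N M : ℕ) (c s : ℝ) (ρ : ℕ → ℝ → ℝ) (t : ℝ) : ℝ :=
  c * ρ 0 t + (c + s * (N + 1)) * ρ (N + 1) t
    + (∑ x ∈ Finset.range N, (c + s * (x + 1)) * ρ (x + 1) t) / M

theorem sum_affine_mul_laplacian (N : ℕ) (c s : ℝ) (u : ℕ → ℝ) :
    ∑ x ∈ Finset.range N, (c + s * (x + 1)) * (u x + u (x + 2) - 2 * u (x + 1))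
      = s * (u 0 - u (N + 1)) - c * (u 1 - u 0) - (c + s * (N + 1)) * (u N - u (N + 1)) := by
  induction N with
  | zero =>
    rw [Finset.sum_range_zero, Nat.cast_zero]
    ring
  | succ n ih =>
    rw [Finset.sum_range_succ, ih]
    push_cast
    ring

namespace IsReservoirHeatFlow

variable {N M : ℕ} {ρ : ℕ → ℝ → ℝ} {t : ℝ}

theorem hasDerivWithinAt_affineMoment (hρ : IsReservoirHeatFlow N M ρ) (c s : ℝ) (ht : 0 ≤ t) :
    HasDerivWithinAt (affineMoment N M c s ρ) (s * (ρ 0 t - ρ (N + 1) t) / (2 * M))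
      (Set.Ici 0) t := by
  have hsum : HasDerivWithinAt (fun t => ∑ x ∈ Finset.range N, (c + s * (x + 1)) * ρ (x + 1) t)
      (∑ x ∈ Finset.range N, (c + s * (x + 1)) * ((ρ x t + ρ (x + 2) t - 2 * ρ (x + 1) t) / 2))
      (Set.Ici 0) t :=
    HasDerivWithinAt.fun_sum fun x hx =>
      (hρ.channel x (Finset.mem_range.mp hx) t ht).const_mul (c + s * (x + 1))
  refine ((((hρ.left t ht).const_mul c).add ((hρ.right t ht).const_mul _)).add
    (hsum.div_const (M : ℝ))).congr_deriv ?_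
  simp only [← mul_div_assoc]
  rw [← Finset.sum_div, sum_affine_mul_laplacian N c s fun x => ρ x t]
  ring

theorem abs_affineMoment_sub_le (hρ : IsReservoirHeatFlow N M ρ) {c s : ℝ}
    (hcs : ∀ x < N, |c + s * (x + 1)| ≤ 1) (ht : 0 ≤ t) :
    |affineMoment N M c s ρ t - (c * ρ 0 t + (c + s * (N + 1)) * ρ (N + 1) t)| ≤ N / M := by
  have hterm (x : ℕ) (hx : x ∈ Finset.range N) : |(c + s * (x + 1)) * ρ (x + 1) t| ≤ 1 := by
    have hx := Finset.mem_range.mp hx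
    have hρx := hρ.mem_Icc (x + 1) (by omega) t ht
    rw [abs_mul, abs_of_nonneg hρx.1]
    exact mul_le_one₀ (hcs x hx) hρx.1 hρx.2
  rw [affineMoment, add_sub_cancel_left, abs_div, Nat.abs_cast]
  gcongr
  exact (Finset.abs_sum_le_sum_abs _ _).trans ((Finset.sum_le_sum hterm).trans (by simp))

theorem abs_reservoir_add_sub_le (hρ : IsReservoirHeatFlow N M ρ) (ht : 0 ≤ t) :
    |ρ 0 t + ρ (N + 1) t - (ρ 0 0 + ρ (N + 1) 0)| ≤ 2 * (N / M) := by
  have h := abs_sub_exp_mul_le_of_hasDerivWithinAt (z := affineMoment N M 1 0 ρ)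
    (D := fun t => ρ 0 t + ρ (N + 1) t) le_rfl
    (fun s hs => (hρ.hasDerivWithinAt_affineMoment 1 0 hs).congr_deriv (by ring))
    (fun s hs => by simpa using hρ.abs_affineMoment_sub_le (c := 1) (s := 0) (by simp) hs) ht
  simpa using h

theorem abs_reservoir_sub_sub_le (hρ : IsReservoirHeatFlow N M ρ) (ht : 0 ≤ t) :
    |ρ (N + 1) t - ρ 0 t - Real.exp (-(t / (M * (N + 1)))) * (ρ (N + 1) 0 - ρ 0 0)|
      ≤ 2 * (N / M) := by
  have hend : -1 + 2 / (N + 1) * ((N : ℝ) + 1) = 1 := by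
    rw [div_mul_cancel₀ _ (by positivity)]
    norm_num
  have hweight (x : ℕ) (hx : x < N) : |-1 + 2 / ((N : ℝ) + 1) * (x + 1)| ≤ 1 := by
    have hratio := natCast_div_add_one_mem_Icc (Nat.succ_le_succ hx.le)
    rw [Nat.cast_succ] at hratio
    rw [div_mul_eq_mul_div, mul_div_assoc]
    exact abs_le.mpr ⟨by linarith [hratio.1], by linarith [hratio.2]⟩
  have h := abs_sub_exp_mul_le_of_hasDerivWithinAt
    (z := affineMoment N M (-1) (2 / (N + 1)) ρ) (D := fun t => ρ (N + 1) t - ρ 0 t)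
    (lam := 1 / (M * (N + 1))) (by positivity)
    (fun s hs => (hρ.hasDerivWithinAt_affineMoment _ _ hs).congr_deriv (by
      rw [one_div, mul_inv]
      ring))
    (fun s hs => by
      have h := hρ.abs_affineMoment_sub_le hweight hs
      rw [hend] at h
      convert h using 3
      ring) ht
  rwa [one_div_mul_eq_div] at h

theorem abs_left_sub_adiabaticProfile_le (hρ : IsReservoirHeatFlow N M ρ) (ht : 0 ≤ t) :
    |ρ 0 t - adiabaticProfile (ρ 0 0) (ρ (N + 1) 0) 0 (t / (M * (N + 1)))| ≤ 2 * (N / M) := by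
  have hsum := abs_le.mp (hρ.abs_reservoir_add_sub_le ht)
  have hdiff := abs_le.mp (hρ.abs_reservoir_sub_sub_le ht)
  simp only [adiabaticProfile]
  exact abs_le.mpr ⟨by linarith, by linarith⟩

theorem abs_right_sub_adiabaticProfile_le (hρ : IsReservoirHeatFlow N M ρ) (ht : 0 ≤ t) :
    |ρ (N + 1) t - adiabaticProfile (ρ 0 0) (ρ (N + 1) 0) 1 (t / (M * (N + 1)))|
      ≤ 2 * (N / M) := by
  have hsum := abs_le.mp (hρ.abs_reservoir_add_sub_le ht)
  have hdiff := abs_le.mp (hρ.abs_reservoir_sub_sub_le ht)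
  simp only [adiabaticProfile]
  exact abs_le.mpr ⟨by linarith, by linarith⟩

theorem abs_sub_adiabaticProfile_le (hρ : IsReservoirHeatFlow N M ρ) {x : ℕ} (hx : x ≤ N + 1)
    (ht : 0 ≤ t) :
    |ρ x t - adiabaticProfile (ρ 0 0) (ρ (N + 1) 0) (x / (N + 1)) (t / (M * (N + 1)))|
      ≤ 3 * ((N + 1) / M) + 2 * Real.exp (-t / (2 * (N + 1) ^ 2)) := by
  set a := ρ 0 0
  set b := ρ (N + 1) 0
  let u (y : ℕ) (s : ℝ) : ℝ := adiabaticProfile a b (y / (N + 1)) (s / (M * (N + 1)))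
  have ha : a ∈ Set.Icc (0 : ℝ) 1 := hρ.mem_Icc 0 (Nat.zero_le _) 0 le_rfl
  have hb : b ∈ Set.Icc (0 : ℝ) 1 := hρ.mem_Icc (N + 1) le_rfl 0 le_rfl
  have hcompare := abs_le_of_abs_deriv_sub_laplacian_le (N := N) (A := 1)
    (κ := 1 / 2 / (M * (N + 1))) (δ := 2 * (N / M)) (f := fun y s => ρ y s - u y s)
    zero_le_one (by positivity) (by positivity)
    (fun y hy s hs => (hρ.channel y hy s hs).fun_sub
      (hasDerivAt_adiabaticProfile_div _ _ _ _ _).hasDerivWithinAt)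
    (fun y hy s hs => ?_) (fun y hy => ?_) (fun s hs => ?_) (fun s hs => ?_) hx ht
  · refine hcompare.trans ?_
    have hsource : 1 / 2 / ((M : ℝ) * (N + 1)) * (N + 1) ^ 2 = (N + 1) / M / 2 := by
      rw [div_div, ← mul_assoc]
      field_simp
    have hN : (N : ℝ) / M ≤ (N + 1) / M := by gcongr; linarith
    rw [hsource]
    linarith
  · refine le_of_eq_of_le (congrArg abs ?_) (abs_deriv_adiabaticProfile_div_le ha hb
      (natCast_div_add_one_mem_Icc (Nat.succ_le_succ hy.le)) hs (by positivity))
    have hharmonic := adiabaticProfile_laplacian a b (s / (M * (N + 1))) y (N + 1)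
    simp only [u]
    push_cast
    linear_combination hharmonic / 2
  · have hu := adiabaticProfile_zero_mem_Icc ha hb
      (natCast_div_add_one_mem_Icc (Nat.succ_le_succ hy.le))
    have hρy := hρ.mem_Icc (y + 1) (by omega) 0 le_rfl
    simp only [u, zero_div]
    exact abs_le.mpr ⟨by linarith [hρy.1, hu.2], by linarith [hρy.2, hu.1]⟩
  · simpa [u] using hρ.abs_left_sub_adiabaticProfile_le hs
  · have hone : ((N : ℝ) + 1) / (N + 1) = 1 := div_self (by positivity)
    simpa [u, hone] using hρ.abs_right_sub_adiabaticProfile_le hs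

end IsReservoirHeatFlow

end SSEP

/-! ## Adiabatic limit -/

section Scaling

theorem tendsto_natCast_div_add_one : Tendsto (fun N : ℕ => (N : ℝ) / (N + 1)) atTop (𝓝 1) := by
  exact_mod_cast tendsto_natCast_div_add_atTop (1 : ℝ)

theorem eventually_div_natCast_mul_eq (f : ℕ → ℝ) :
    ∀ᶠ N : ℕ in atTop, f N / N * ((N : ℝ) / (N + 1)) = f N / (N + 1) := by
  filter_upwards [eventually_ne_atTop 0] with N hN
  exact div_mul_div_cancel₀ (Nat.cast_ne_zero.mpr hN)

theorem tendsto_div_natCast_add_one {f : ℕ → ℝ} {a : ℝ}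
    (hf : Tendsto (fun N : ℕ => f N / N) atTop (𝓝 a)) :
    Tendsto (fun N : ℕ => f N / (N + 1)) atTop (𝓝 a) := by
  rw [← mul_one a]
  exact (hf.mul tendsto_natCast_div_add_one).congr' (eventually_div_natCast_mul_eq f)

theorem tendsto_div_natCast_add_one_atTop {f : ℕ → ℝ}
    (hf : Tendsto (fun N : ℕ => f N / N) atTop atTop) :
    Tendsto (fun N : ℕ => f N / (N + 1)) atTop atTop :=
  (hf.atTop_mul_pos one_pos tendsto_natCast_div_add_one).congr' (eventually_div_natCast_mul_eq f)

theorem tendsto_natFloor_mul_div_add_one {r : ℝ} (hr : 0 ≤ r) :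
    Tendsto (fun N : ℕ => (⌊(N : ℝ) * r⌋₊ : ℝ) / (N + 1)) atTop (𝓝 r) := by
  refine tendsto_div_natCast_add_one ?_
  simp_rw [mul_comm _ r]
  exact (tendsto_nat_floor_mul_div_atTop hr).comp tendsto_natCast_atTop_atTop

variable {α : ℝ} {M : ℕ → ℝ}

theorem tendsto_div_natCast_atTop_of_div_rpow (hα : 0 < α)
    (hM : Tendsto (fun N : ℕ => M N / (N : ℝ) ^ (1 + α)) atTop (𝓝 1)) :
    Tendsto (fun N : ℕ => M N / N) atTop atTop := by
  have hpow : Tendsto (fun N : ℕ => (N : ℝ) ^ α) atTop atTop :=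
    (tendsto_rpow_atTop hα).comp tendsto_natCast_atTop_atTop
  refine (hM.pos_mul_atTop one_pos hpow).congr' ?_
  filter_upwards [eventually_gt_atTop 0] with N hN
  have hN' : (0 : ℝ) < N := Nat.cast_pos.mpr hN
  rw [Real.rpow_add hN', Real.rpow_one]
  field_simp

theorem tendsto_rpow_two_add_div (hM : Tendsto (fun N : ℕ => M N / (N : ℝ) ^ (1 + α)) atTop (𝓝 1)) :
    Tendsto (fun N : ℕ => (N : ℝ) ^ (2 + α) / (M N * N)) atTop (𝓝 1) := by
  rw [← inv_one]
  refine (hM.inv₀ one_ne_zero).congr' ?_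
  filter_upwards [eventually_gt_atTop 0] with N hN
  have hN' : (0 : ℝ) < N := Nat.cast_pos.mpr hN
  rw [show 2 + α = 1 + α + 1 by ring, Real.rpow_add_one hN'.ne', mul_div_mul_right _ _ hN'.ne',
    inv_div]

end Scaling

section ConvergenceInProbability

theorem abs_integral_sub_le_add_measureReal {Ω : Type*} [MeasurableSpace Ω] {P : Measure Ω}
    [IsProbabilityMeasure P] {Y : Ω → ℝ} {C v δ : ℝ} (hY : Measurable Y) (hC : ∀ w, |Y w| ≤ C)
    (hδ : 0 ≤ δ) : |∫ w, Y w ∂P - v| ≤ δ + (C + |v|) * P.real {w | δ < |Y w - v|} := by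
  have hA : MeasurableSet {w | δ < |Y w - v|} :=
    measurableSet_lt measurable_const (hY.sub_const v).abs
  have hint : Integrable Y P := Integrable.of_bound hY.aestronglyMeasurable C (ae_of_all _ hC)
  have hbound (w : Ω) : |Y w - v| ≤ δ + {w | δ < |Y w - v|}.indicator (fun _ => C + |v|) w := by
    by_cases hw : w ∈ {w | δ < |Y w - v|}
    · rw [Set.indicator_of_mem hw]
      linarith [abs_sub (Y w) v, hC w]
    · rw [Set.indicator_of_notMem hw, add_zero]
      exact not_lt.mp hw
  calc |∫ w, Y w ∂P - v| = |∫ w, (Y w - v) ∂P| := by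
        rw [integral_sub hint (integrable_const v), integral_const, probReal_univ, one_smul]
    _ ≤ ∫ w, |Y w - v| ∂P := abs_integral_le_integral_abs
    _ ≤ ∫ w, (δ + {w | δ < |Y w - v|}.indicator (fun _ => C + |v|) w) ∂P :=
        integral_mono (hint.sub (integrable_const v)).abs
          ((integrable_const δ).add ((integrable_const _).indicator hA)) hbound
    _ = δ + (C + |v|) * P.real {w | δ < |Y w - v|} := by
        rw [integral_add (integrable_const δ) ((integrable_const _).indicator hA), integral_const,
          probReal_univ, one_smul, integral_indicator_const _ hA, smul_eq_mul, mul_comm (P.real _)]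

theorem tendsto_integral_of_tendsto_measure {ι : Type*} {l : Filter ι} {Ω : ι → Type*}
    [∀ i, MeasurableSpace (Ω i)] {P : ∀ i, Measure (Ω i)} [∀ i, IsProbabilityMeasure (P i)]
    {Y : ∀ i, Ω i → ℝ} {C v : ℝ} (hY : ∀ i, Measurable (Y i)) (hC : ∀ i w, |Y i w| ≤ C)
    (hv : ∀ δ : ℝ, 0 < δ → Tendsto (fun i => P i {w | δ < |Y i w - v|}) l (𝓝 0)) :
    Tendsto (fun i => ∫ w, Y i w ∂P i) l (𝓝 v) := by
  refine Metric.tendsto_nhds.mpr fun ε hε => ?_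
  have hprob : Tendsto (fun i => ε / 2 + (C + |v|) * (P i).real {w | ε / 2 < |Y i w - v|}) l
      (𝓝 (ε / 2)) := by
    simpa [measureReal_def] using (((ENNReal.tendsto_toReal ENNReal.zero_ne_top).comp
      (hv (ε / 2) (half_pos hε))).const_mul (C + |v|)).const_add (ε / 2)
  filter_upwards [hprob.eventually_lt_const (half_lt_self hε)] with i hi
  exact (abs_integral_sub_le_add_measureReal (hY i) (hC i) (half_pos hε).le).trans_lt hi

end ConvergenceInProbability

namespace SSEP

theorem tendsto_apply_of_isReservoirHeatFlow {M x : ℕ → ℕ} {ρ : ℕ → ℕ → ℝ → ℝ} {T : ℕ → ℝ}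
    {a b r t : ℝ} (hρ : ∀ᶠ N in atTop, IsReservoirHeatFlow N (M N) (ρ N))
    (hM : Tendsto (fun N : ℕ => (M N : ℝ) / (N + 1)) atTop atTop)
    (ha : Tendsto (fun N => ρ N 0 0) atTop (𝓝 a))
    (hb : Tendsto (fun N => ρ N (N + 1) 0) atTop (𝓝 b)) (hx : ∀ N, x N ≤ N + 1)
    (hr : Tendsto (fun N : ℕ => (x N : ℝ) / (N + 1)) atTop (𝓝 r)) (ht : 0 < t)
    (hT : Tendsto (fun N : ℕ => T N / (M N * (N + 1))) atTop (𝓝 t)) :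
    Tendsto (fun N => ρ N (x N) (T N)) atTop (𝓝 (adiabaticProfile a b r t)) := by
  have hM_inv : Tendsto (fun N : ℕ => ((N : ℝ) + 1) / M N) atTop (𝓝 0) :=
    hM.inv_tendsto_atTop.congr fun N => inv_div _ _
  have hdiffusive : Tendsto (fun N : ℕ => T N / (2 * ((N : ℝ) + 1) ^ 2)) atTop atTop := by
    refine ((hT.pos_mul_atTop ht hM).atTop_div_const two_pos).congr' ?_
    filter_upwards [hM.eventually_gt_atTop 0] with N hN
    have hMN : (M N : ℝ) ≠ 0 := fun h => by simp [h] at hN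
    field_simp
  have herror : Tendsto (fun N : ℕ => 3 * (((N : ℝ) + 1) / M N)
      + 2 * Real.exp (-T N / (2 * ((N : ℝ) + 1) ^ 2))) atTop (𝓝 0) := by
    simp only [neg_div]
    simpa using (hM_inv.const_mul 3).add
      ((Real.tendsto_exp_neg_atTop_nhds_zero.comp hdiffusive).const_mul 2)
  have hprofile : Tendsto (fun N : ℕ => adiabaticProfile (ρ N 0 0) (ρ N (N + 1) 0) (x N / (N + 1))
      (T N / (M N * (N + 1)))) atTop (𝓝 (adiabaticProfile a b r t)) :=
    ((ha.add hb).div_const 2).add (((hb.sub ha).mul (hr.sub_const _)).mul hT.neg.rexp)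
  refine (tendsto_iff_of_dist (squeeze_zero' (Eventually.of_forall fun _ => dist_nonneg) ?_
    herror)).mpr hprofile
  filter_upwards [hρ, hdiffusive.eventually_ge_atTop 0] with N hflow hTN
  have hTN : 0 ≤ T N := by
    by_contra! hneg
    exact hTN.not_gt (div_neg_of_neg_of_pos hneg (by positivity))
  exact hflow.abs_sub_adiabaticProfile_le (hx N) hTN

section Limit

variable {M : ℕ → ℕ} {Ω : ℕ → Type*} [∀ N, MeasurableSpace (Ω N)] {P : ∀ N, Measure (Ω N)}
  [∀ N, IsProbabilityMeasure (P N)] {X : ∀ N, ℝ → Ω N → State N (M N)}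

theorem tendsto_density_of_tendsto_measure {x : ℕ → ℕ} {t v : ℝ}
    (hX : ∀ N, Measurable (X N t))
    (hv : ∀ δ : ℝ, 0 < δ →
      Tendsto (fun N => P N {w | δ < |(X N t w).occ (x N) - v|}) atTop (𝓝 0)) :
    Tendsto (fun N => density (P N) (X N) (x N) t) atTop (𝓝 v) :=
  tendsto_integral_of_tendsto_measure (C := 1)
    (fun N => (measurable_of_finite fun ω : State N (M N) => ω.occ (x N)).comp (hX N))
    (fun N w => abs_le.mpr
      ⟨by linarith [((X N t w).occ_mem_Icc (x N)).1], ((X N t w).occ_mem_Icc (x N)).2⟩) hv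

theorem tendsto_density_adiabaticProfile {a b r t : ℝ} {x : ℕ → ℕ} {θ : ℕ → ℝ}
    (hX : ∀ N, IsMarkovProcess (P N) (generator N (M N)) (X N))
    (hM : Tendsto (fun N : ℕ => (M N : ℝ) / N) atTop atTop)
    (hθ : Tendsto (fun N : ℕ => θ N / (M N * N)) atTop (𝓝 1))
    (ha : Tendsto (fun N => density (P N) (X N) 0 0) atTop (𝓝 a))
    (hb : Tendsto (fun N => density (P N) (X N) (N + 1) 0) atTop (𝓝 b)) (hx : ∀ N, x N ≤ N + 1)
    (hr : Tendsto (fun N : ℕ => (x N : ℝ) / (N + 1)) atTop (𝓝 r)) (ht : 0 < t) :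
    Tendsto (fun N => density (P N) (X N) (x N) (θ N * t)) atTop
      (𝓝 (adiabaticProfile a b r t)) := by
  have hflow : ∀ᶠ N in atTop, IsReservoirHeatFlow N (M N) (density (P N) (X N)) := by
    filter_upwards [eventually_gt_atTop 0] with N hN
    exact isReservoirHeatFlow_density hN (hX N)
  have hθ' : Tendsto (fun N : ℕ => θ N / M N / (N + 1)) atTop (𝓝 1) :=
    tendsto_div_natCast_add_one (by simpa only [div_div] using hθ)
  have hT : Tendsto (fun N : ℕ => θ N * t / (M N * (N + 1))) atTop (𝓝 t) := by
    simpa only [div_div, div_mul_eq_mul_div, one_mul] using hθ'.mul_const t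
  exact tendsto_apply_of_isReservoirHeatFlow hflow (tendsto_div_natCast_add_one_atTop hM) ha hb hx
    hr ht hT

end Limit

end SSEP

open SSEP in
theorem mainTheorem4_general
    {M : ℕ → ℕ} {θ : ℕ → ℝ}
    (hM : Tendsto (fun N : ℕ => (M N : ℝ) / N) atTop atTop)
    (hθ : Tendsto (fun N : ℕ => θ N / (M N * N)) atTop (𝓝 1))
    {Ω : ℕ → Type*} [∀ N, MeasurableSpace (Ω N)]
    {P : ∀ N, Measure (Ω N)} [∀ N, IsProbabilityMeasure (P N)]
    {X : ∀ N, ℝ → Ω N → State N (M N)}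
    (hX : ∀ N, IsMarkovProcess (P N) (generator N (M N)) (X N))
    {vm₀ vp₀ : ℝ}
    (hleft : Tendsto (fun N => density (P N) (X N) 0 0) atTop (𝓝 vm₀))
    (hright : Tendsto (fun N => density (P N) (X N) (N + 1) 0) atTop (𝓝 vp₀)) :
    ∃ vm vp : ℝ → ℝ,
      (∀ t : ℝ, 0 < t → HasDerivAt vm ((1 / 2) * (vp t - vm t)) t) ∧
      (∀ t : ℝ, 0 < t → HasDerivAt vp (-(1 / 2) * (vp t - vm t)) t) ∧
      vm 0 = vm₀ ∧ vp 0 = vp₀ ∧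
      Tendsto vm (𝓝[>] 0) (𝓝 vm₀) ∧ Tendsto vp (𝓝[>] 0) (𝓝 vp₀) ∧
      (∀ t : ℝ, 0 ≤ t → vm t = (vm₀ + vp₀) / 2 + (vm₀ - vp₀) / 2 * Real.exp (-t)) ∧
      (∀ t : ℝ, 0 ≤ t → vp t = (vm₀ + vp₀) / 2 - (vm₀ - vp₀) / 2 * Real.exp (-t)) ∧
      (∀ t : ℝ, 0 < t → Tendsto
        (fun N : ℕ => density (P N) (X N) 0 (θ N * t)) atTop (𝓝 (vm t))) ∧
      (∀ t : ℝ, 0 < t → Tendsto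
        (fun N : ℕ => density (P N) (X N) (N + 1) (θ N * t)) atTop (𝓝 (vp t))) ∧
      (∀ r ∈ Set.Icc (0 : ℝ) 1, ∀ t : ℝ, 0 < t → Tendsto
        (fun N : ℕ => density (P N) (X N) ⌊(N : ℝ) * r⌋₊ (θ N * t))
        atTop (𝓝 ((vp t - vm t) * r + vm t))) := by
  refine ⟨adiabaticProfile vm₀ vp₀ 0, adiabaticProfile vm₀ vp₀ 1,
    fun t _ => hasDerivAt_adiabaticProfile_left vm₀ vp₀ t,
    fun t _ => hasDerivAt_adiabaticProfile_right vm₀ vp₀ t,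
    by simp [adiabaticProfile_zero], by simp [adiabaticProfile_zero],
    by simpa using tendsto_adiabaticProfile_nhdsGT_zero vm₀ vp₀ 0,
    by simpa using tendsto_adiabaticProfile_nhdsGT_zero vm₀ vp₀ 1,
    fun t _ => by simp only [adiabaticProfile]; ring,
    fun t _ => by simp only [adiabaticProfile]; ring,
    fun t ht => ?_, fun t ht => ?_, fun r hr t ht => ?_⟩
  · exact tendsto_density_adiabaticProfile hX hM hθ hleft hright (fun N => Nat.zero_le _)
      (by simp) ht
  · refine tendsto_density_adiabaticProfile hX hM hθ hleft hright (fun N => le_rfl) ?_ ht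
    refine tendsto_const_nhds.congr fun N => ?_
    push_cast
    exact (div_self (by positivity)).symm
  · rw [← adiabaticProfile_eq_interpolation]
    refine tendsto_density_adiabaticProfile hX hM hθ hleft hright (fun N => ?_)
      (tendsto_natFloor_mul_div_add_one hr.1) ht
    exact Nat.le_succ_of_le (Nat.floor_le_of_le (mul_le_of_le_one_right N.cast_nonneg hr.2))

theorem mainTheorem4
    (α : ℝ) (hα : 0 < α)
    -- the reservoir sizes, `M N ~ N ^ (1 + α)`
    (M : ℕ → ℕ)
    (hM : Tendsto (fun N : ℕ => (M N : ℝ) / (N : ℝ) ^ (1 + α)) atTop (𝓝 1))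
    -- for every `N`, the particle process, with its own probability space
    {Ω : ℕ → Type*} [∀ N, MeasurableSpace (Ω N)]
    (P : ∀ N, Measure (Ω N)) [∀ N, IsProbabilityMeasure (P N)]
    (X : ∀ N, ℝ → Ω N → SSEP.State N (M N))
    (hX : ∀ N, IsMarkovProcess (P N) (SSEP.generator N (M N)) (X N))
    -- the initial data
    (u₀ : ℝ → ℝ) (hu₀ : ContinuousOn u₀ (Set.Ioo 0 1))
    (hu₀' : ∀ r ∈ Set.Ioo (0 : ℝ) 1, u₀ r ∈ Set.Icc (0 : ℝ) 1)
    (vm₀ vp₀ : ℝ) (hvm₀ : vm₀ ∈ Set.Icc (0 : ℝ) 1) (hvp₀ : vp₀ ∈ Set.Icc (0 : ℝ) 1)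
    (hleft : ∀ δ : ℝ, 0 < δ → Tendsto
      (fun N => P N {w | δ < |((X N 0 w).nLeft.val : ℝ) / M N - vm₀|}) atTop (𝓝 0))
    (hright : ∀ δ : ℝ, 0 < δ → Tendsto
      (fun N => P N {w | δ < |((X N 0 w).nRight.val : ℝ) / M N - vp₀|}) atTop (𝓝 0))
    (hchannel : ∀ N x : ℕ, 1 ≤ x → x ≤ N →
      SSEP.density (P N) (X N) x 0 = u₀ ((x : ℝ) / N)) :
    ∃ vm vp : ℝ → ℝ,
      -- the system of differential equations with its initial conditions
      (∀ t : ℝ, 0 < t → HasDerivAt vm ((1 / 2) * (vp t - vm t)) t) ∧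
      (∀ t : ℝ, 0 < t → HasDerivAt vp (-(1 / 2) * (vp t - vm t)) t) ∧
      vm 0 = vm₀ ∧ vp 0 = vp₀ ∧
      Tendsto vm (𝓝[>] 0) (𝓝 vm₀) ∧ Tendsto vp (𝓝[>] 0) (𝓝 vp₀) ∧
      -- its explicit solution
      (∀ t : ℝ, 0 ≤ t → vm t = (vm₀ + vp₀) / 2 + (vm₀ - vp₀) / 2 * Real.exp (-t)) ∧
      (∀ t : ℝ, 0 ≤ t → vp t = (vm₀ + vp₀) / 2 - (vm₀ - vp₀) / 2 * Real.exp (-t)) ∧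
      -- the limits of the reservoir densities and of the channel density
      (∀ t : ℝ, 0 < t → Tendsto
        (fun N : ℕ => SSEP.density (P N) (X N) 0 ((N : ℝ) ^ (2 + α) * t))
        atTop (𝓝 (vm t))) ∧
      (∀ t : ℝ, 0 < t → Tendsto
        (fun N : ℕ => SSEP.density (P N) (X N) (N + 1) ((N : ℝ) ^ (2 + α) * t))
        atTop (𝓝 (vp t))) ∧
      (∀ r ∈ Set.Icc (0 : ℝ) 1, ∀ t : ℝ, 0 < t → Tendsto
        (fun N : ℕ => SSEP.density (P N) (X N) ⌊(N : ℝ) * r⌋₊ ((N : ℝ) ^ (2 + α) * t))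
        atTop (𝓝 ((vp t - vm t) * r + vm t))) :=
  mainTheorem4_general (tendsto_div_natCast_atTop_of_div_rpow hα hM)
    (tendsto_rpow_two_add_div hM) hX
    (SSEP.tendsto_density_of_tendsto_measure (fun N => (hX N).measurable 0 le_rfl)
      (by simpa only [SSEP.State.occ_zero] using hleft))
    (SSEP.tendsto_density_of_tendsto_measure (fun N => (hX N).measurable 0 le_rfl)
      (by simpa only [SSEP.State.occ_last] using hright))
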